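/- Let $\Theta\subset\mathbb{R}^2$ be compact with $\theta_1\neq 0$ for all $\theta=(\theta_1,\theta_2)\in\Theta$, and consider, in $V=L^2(\mathbb{R})$ (real-valued) and on the unbounded time interval $\mathbb{R}_+=[0,\infty)$, the transport problem $$\partial_t u+\theta_2\,\partial_x u=0,\qquad u(0,x)=\frac{1}{\sqrt{2\pi}\,\theta_1}\exp\Big(-\frac{x^2}{2\theta_1^2}\Big).$$ A solution is a function $u\in C(\mathbb{R}_+;V)$ with this initial value such that $\frac{d}{dt}\int_{\mathbb{R}}u(t,x)\varphi(x)\,dx=\theta_2\int_{\mathbb{R}}u(t,x)\varphi'(x)\,dx$ for all $\varphi\in C_c^\infty(\mathbb{R})$ and all $t\ge 0$ (with the one-sided derivative at $t=0$). Let $\mathcal{M}\subset C(\mathbb{R}_+;V)$ be the set of all solutions for all $\theta\in\Theta$, let $\mathcal{M}(t)=\{u(t,\cdot):u\in\mathcal{M}\}\subset V$, and let $$d_n(\mathcal{M}(t))=\inf_{\dim Y\le n}\ \sup_{w\in\mathcal{M}(t)}\ \inf_{v\in Y}\|w-v\|_{V},\qquad d_n(\mathcal{M})=\inf_{\dim Y\le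 n}\ \sup_{u\in\mathcal{M}}\ \sup_{t\ge 0}\ \inf_{v\in Y}\|u(t,\cdot)-v\|_{V}$$ be the Kolmogorov $n$-widths, where $Y$ ranges over the linear subspaces of $V$ of dimension at most $n$. Then: 1. For each $\theta\in\Theta$ there is exactly one solution, and for every $t\ge0$ it is given by $u(t,x)=\frac{1}{\sqrt{2\pi}\,\theta_1}\exp\big(-\frac{(x-t\theta_2)^2}{2\theta_1^2}\big)$ for almost every $x$. 2. For each fixed $t\ge 0$ the widths $d_n(\mathcal{M}(t))$ decay exponentially in $n$: there are $C,c>0$, depending on $t$ and $\Theta$, with $d_n(\mathcal{M}(t))\le C e^{-cn}$ for all $n\in\mathbb{N}=\{0,1,2,\dots\}$. 3. The widths $d_n(\mathcal{M})$ are bounded: there is $C>0$, depending on $\Theta$, with $d_n(\mathcal{M})\le C$ for all $n\in\mathbb{N}$. If moreover $\theta_2\ne0$ for at least one $\theta\in\Theta$, they do not decay: there is $c>0$, depending on $\Theta$, with $d_n(\mathcal{M})\ge c$ for all $n\in\mathbb{N}$. -/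

import Mathlib

open MeasureTheory Set
open scoped ENNReal NNReal ContDiff

/-- The state space `L²(ℝ)` of real-valued square-integrable functions on the line. -/
abbrev StateSpace : Type := Lp ℝ 2 (volume : Measure ℝ)

section Widths

variable {V : Type*} [NormedAddCommGroup V] [NormedSpace ℝ V]

/-- `dist(K, Y) = sup_{u ∈ K} inf_{v ∈ Y} ‖u - v‖` for a set `K` of states, in `[0, ∞]`. -/
noncomputable def worstDist (K : Set V) (Y : Submodule ℝ V) : ℝ≥0∞ :=
  ⨆ u ∈ K, Metric.infEDist u (Y : Set V)

/-- The Kolmogorov `n`-width of a set of states: the infimum of `dist(K, Y)` over all linear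
subspaces `Y` of dimension at most `n`. -/
noncomputable def kolmogorovWidth (n : ℕ) (K : Set V) : ℝ≥0∞ :=
  ⨅ (Y : Submodule ℝ V) (_ : FiniteDimensional ℝ Y ∧ Module.finrank ℝ Y ≤ n), worstDist K Y

/-- `dist(M, Y) = sup_{u ∈ M} sup_{t ≥ 0} inf_{v ∈ Y} ‖u(t) - v‖` for a set `M` of
trajectories. -/
noncomputable def trajectoryDist (M : Set C(ℝ≥0, V)) (Y : Submodule ℝ V) : ℝ≥0∞ :=
  ⨆ u ∈ M, ⨆ t : ℝ≥0, Metric.infEDist (u t) (Y : Set V)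

/-- The Kolmogorov `n`-width of a set of trajectories: one subspace of dimension at most `n` has
to serve all trajectories at all times. -/
noncomputable def trajectoryWidth (n : ℕ) (M : Set C(ℝ≥0, V)) : ℝ≥0∞ :=
  ⨅ (Y : Submodule ℝ V) (_ : FiniteDimensional ℝ Y ∧ Module.finrank ℝ Y ≤ n), trajectoryDist M Y

/-- The time slice `M(t) = {u(t) : u ∈ M}`. -/
def timeSlice (M : Set C(ℝ≥0, V)) (t : ℝ≥0) : Set V :=
  (fun u : C(ℝ≥0, V) => u t) '' M

end Widths

/-- The initial Gaussian of width `θ₁`. -/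
noncomputable def initialGaussian (θ : ℝ × ℝ) (x : ℝ) : ℝ :=
  1 / (Real.sqrt (2 * Real.pi) * θ.1) * Real.exp (-(x ^ 2 / (2 * θ.1 ^ 2)))

/-- The Gaussian of width `θ₁` centred at `t θ₂`. -/
noncomputable def travellingGaussian (θ : ℝ × ℝ) (t x : ℝ) : ℝ :=
  1 / (Real.sqrt (2 * Real.pi) * θ.1) * Real.exp (-((x - t * θ.2) ^ 2 / (2 * θ.1 ^ 2)))

/-- `u ∈ C(ℝ₊; L²(ℝ))` solves `∂ₜ u + θ₂ ∂ₓ u = 0` with the Gaussian of width `θ₁` as initial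
value. The equation is understood weakly in space: `d/dt ∫ u(t) φ = θ₂ ∫ u(t) φ'` for all `t ≥ 0`
(one-sided at `t = 0`) and all smooth compactly supported `φ`. -/
structure IsTransportSolution (θ : ℝ × ℝ) (u : C(ℝ≥0, StateSpace)) : Prop where
  initial : (u 0 : ℝ → ℝ) =ᵐ[volume] initialGaussian θ
  equation : ∀ φ : ℝ → ℝ, ContDiff ℝ ∞ φ → HasCompactSupport φ → ∀ t : ℝ, 0 ≤ t →
    HasDerivWithinAt (fun s : ℝ => ∫ x, (u s.toNNReal : ℝ → ℝ) x * φ x)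
      (θ.2 * ∫ x, (u t.toNNReal : ℝ → ℝ) x * deriv φ x) (Ici 0) t

/-- The set of all trajectories of the transport problem with parameter in `Θ`. -/
def transportTrajectories (Θ : Set (ℝ × ℝ)) : Set C(ℝ≥0, StateSpace) :=
  {u | ∃ θ ∈ Θ, IsTransportSolution θ u}

/-!
The proof rests on three facts.

*Well-posedness.* A weak solution `u` paired with a test function that is transported backwards
along the characteristics, `s ↦ ∫ u(s, x) φ(x + (t - s) θ₂) dx`, has vanishing derivative: the weak
equation and the motion of the test function cancel (`hasDerivWithinAt_pairing_zero`). Hence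
`u(t) = u(0)(· - t θ₂)`, and conversely translates of a state are weak solutions
(`isTransportSolution_iff`).

*Fixed times.* At time `t` every solution has the form `A exp(-a x² + b x)`, where by compactness
`A` and `b` are bounded and `0 < α ≤ a ≤ a₀`. Writing this as
`A exp(-a₀ x²) exp((a₀ - a) x² + b x)` and keeping `K` terms of the Taylor series of the last
factor gives a polynomial of degree less than `2 K` times the fixed Gaussian `exp(-a₀ x²)`. The
remainder after `K` terms is at most `ρ⁻ᴷ exp(ρ |(a₀ - a) x² + b x|)` for each `ρ ≥ 1`, and since
`a₀ - a ≤ a₀ - α < a₀` some `ρ > 1` leaves the product with `exp(-a₀ x²)` bounded by a Gaussian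
(`exists_approx_gaussian`). The approximating space, of dimension at most `2 K`, does not depend on
the parameter, and this is exponential decay, although the parameter set is two-dimensional.

*All times.* Translations are isometries, so the zero subspace bounds the widths. Translates of a
state tend weakly to zero, so their projections onto a finite-dimensional subspace tend to zero in
norm and their distances to it tend to the full norm (`tendsto_starProjection_shiftState`). A
Gaussian with `θ₂ ≠ 0` therefore keeps every width at least as large as its norm.
-/

/-! ### Translations of square-integrable functions -/

/-- The translate `x ↦ f (x - a)` of a state, through the action of `ℝ` on `L²(ℝ)`. -/
noncomputable def shiftState (a : ℝ) (f : StateSpace) : StateSpace :=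
  DomAddAct.mk (-a) +ᵥ f

lemma shiftState_ae (a : ℝ) (f : StateSpace) :
    (shiftState a f : ℝ → ℝ) =ᵐ[volume] fun x => f (x - a) := by
  filter_upwards [DomAddAct.vadd_Lp_ae_eq (DomAddAct.mk (-a)) f] with x hx
  simpa [shiftState, neg_add_eq_sub] using hx

lemma norm_shiftState (a : ℝ) (f : StateSpace) : ‖shiftState a f‖ = ‖f‖ :=
  DomAddAct.norm_vadd_Lp _ _

lemma shiftState_zero (f : StateSpace) : shiftState 0 f = f := by
  refine Lp.ext ?_
  simpa using shiftState_ae 0 f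

lemma continuous_shiftState (f : StateSpace) : Continuous fun a => shiftState a f := by
  have : Fact ((2 : ℝ≥0∞) ≠ ⊤) := ⟨by norm_num⟩
  have : Continuous fun a : ℝ => DomAddAct.mk (-a) :=
    DomAddAct.continuous_mk.comp continuous_neg
  exact this.vadd continuous_const

lemma integral_shiftState_mul (a : ℝ) (f : StateSpace) (φ : ℝ → ℝ) :
    ∫ x, shiftState a f x * φ x = ∫ x, f x * φ (x + a) := by
  rw [← integral_sub_right_eq_self (fun x => f x * φ (x + a)) a]
  refine integral_congr_ae ?_
  filter_upwards [shiftState_ae a f] with x hx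
  simp [hx]

lemma integrable_mul_of_memLp (f : StateSpace) {g : ℝ → ℝ} (hg : MemLp g 2 volume) :
    Integrable fun x => f x * g x :=
  (Lp.memLp f).integrable_mul hg

lemma hasCompactSupport_comp_add {φ : ℝ → ℝ} (hc : HasCompactSupport φ) (a : ℝ) :
    HasCompactSupport fun x => φ (x + a) :=
  hc.comp_homeomorph (Homeomorph.addRight a)

lemma integral_mul_eq_inner (f : StateSpace) {g : ℝ → ℝ} (hg : MemLp g 2 volume) :
    ∫ x, f x * g x = inner ℝ (hg.toLp g) f := by
  rw [L2.inner_def]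
  refine integral_congr_ae ?_
  filter_upwards [hg.coeFn_toLp] with x hx
  simp [hx]

lemma abs_integral_mul_le (f k : StateSpace) {g : ℝ → ℝ} (hg : MemLp g 2 volume) {c : ℝ}
    (h : ∀ᵐ x, |g x| ≤ c * |k x|) : |∫ x, f x * g x| ≤ c * ‖k‖ * ‖f‖ := by
  rw [integral_mul_eq_inner f hg]
  refine (abs_real_inner_le_norm _ _).trans ?_
  gcongr
  refine Lp.norm_le_mul_norm_of_ae_le_mul ?_
  filter_upwards [h, hg.coeFn_toLp] with x hx hx'
  simpa [hx'] using hx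

/-- Differentiating the translation of a test function under the integral sign. -/
lemma hasDerivAt_integral_mul_comp_add (f : StateSpace) {φ : ℝ → ℝ} (hφ : ContDiff ℝ ∞ φ)
    (hc : HasCompactSupport φ) (a : ℝ) :
    HasDerivAt (fun b => ∫ x, f x * φ (x + b)) (∫ x, f x * deriv φ (x + a)) a := by
  -- The integral is the convolution of `f` with the reflection of `φ`, evaluated at `-b`.
  have hψ : ContDiff ℝ 1 (fun y => φ (-y)) := (hφ.of_le (by simp)).comp contDiff_neg
  have hcψ : HasCompactSupport (fun y => φ (-y)) := hc.comp_homeomorph (Homeomorph.neg ℝ)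
  have hf : LocallyIntegrable (f : ℝ → ℝ) volume := (Lp.memLp f).locallyIntegrable (by norm_num)
  have key := hcψ.hasDerivAt_convolution_right (ContinuousLinearMap.mul ℝ ℝ) hf hψ (-a)
  have key2 := HasDerivAt.scomp a key (hasDerivAt_neg a)
  have e : deriv (fun y => φ (-y)) = fun y => -deriv φ (-y) := by
    ext y; exact deriv_comp_neg φ y
  have hF : (fun b => ∫ x, f x * φ (x + b)) =
      convolution f (fun y => φ (-y)) (ContinuousLinearMap.mul ℝ ℝ) volume ∘ Neg.neg := by
    ext b
    simp [convolution_def, add_comm]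
  rw [hF]
  refine key2.congr_deriv ?_
  simp [convolution_def, e, integral_neg, add_comm]

/-! ### Well-posedness of the transport equation -/

/-- The pairing of a weak solution with a test function that moves backwards along the
characteristics has vanishing derivative. The product rule splits the increment into the weak
equation, the motion of the test function, and a mixed term `o(s - t)`. -/
lemma hasDerivWithinAt_pairing_zero {v : ℝ} {u : C(ℝ≥0, StateSpace)}
    (hu : ∀ φ : ℝ → ℝ, ContDiff ℝ ∞ φ → HasCompactSupport φ → ∀ t : ℝ, 0 ≤ t →
      HasDerivWithinAt (fun s : ℝ => ∫ x, (u s.toNNReal : ℝ → ℝ) x * φ x)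
        (v * ∫ x, (u t.toNNReal : ℝ → ℝ) x * deriv φ x) (Ici 0) t)
    {φ : ℝ → ℝ} (hφ : ContDiff ℝ ∞ φ) (hc : HasCompactSupport φ) {t : ℝ} (ht : 0 ≤ t) :
    HasDerivWithinAt (fun s : ℝ => ∫ x, (u s.toNNReal : ℝ → ℝ) x * φ (x + (t - s) * v))
      0 (Ici 0) t := by
  have hm : ∀ a, MemLp (fun x => φ (x + a)) 2 volume := fun a =>
    (hφ.continuous.comp (continuous_add_const a)).memLp_of_hasCompactSupport
      (hasCompactSupport_comp_add hc a)
  have hm0 : MemLp φ 2 volume := by simpa using hm 0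
  have h1 := hu φ hφ hc t ht
  have h2 : HasDerivAt (fun s : ℝ => ∫ x, (u t.toNNReal : ℝ → ℝ) x * φ (x + (t - s) * v))
      (-(v * ∫ x, (u t.toNNReal : ℝ → ℝ) x * deriv φ x)) t := by
    have hin : HasDerivAt (fun s : ℝ => (t - s) * v) (-v) t := by
      simpa using ((hasDerivAt_id t).const_sub t).mul_const v
    have := HasDerivAt.scomp t (hasDerivAt_integral_mul_comp_add (u t.toNNReal) hφ hc ((t - t) * v))
      hin
    simpa [Function.comp_def] using this
  -- The mixed increment is `o(s - t)`: `u` is continuous and `φ` is Lipschitz under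
  -- translation in `L²`.
  have h3 : HasDerivWithinAt (fun s : ℝ => ∫ x, (u s.toNNReal - u t.toNNReal : StateSpace) x *
      (φ (x + (t - s) * v) - φ x)) 0 (Ici 0) t := by
    obtain ⟨K, hK⟩ := ContDiff.lipschitzWith_of_hasCompactSupport hc hφ (by simp)
    set S : Set ℝ := Metric.cthickening 1 (tsupport φ)
    have hS : IsCompact S := hc.isCompact.cthickening
    set k : StateSpace := indicatorConstLp 2 hS.measurableSet hS.measure_lt_top.ne (1 : ℝ)
    have hk : (k : ℝ → ℝ) =ᵐ[volume] S.indicator fun _ => 1 := indicatorConstLp_coeFn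
    have hsmall : ∀ᶠ s in nhdsWithin t (Ici 0), |(t - s) * v| ≤ 1 := by
      have : Filter.Tendsto (fun s : ℝ => |(t - s) * v|) (nhdsWithin t (Ici 0)) (nhds 0) := by
        have : Continuous fun s : ℝ => |(t - s) * v| := by fun_prop
        simpa using (this.tendsto t).mono_left nhdsWithin_le_nhds
      exact (this.eventually (gt_mem_nhds zero_lt_one)).mono fun _ h => h.le
    have hcont : Filter.Tendsto (fun s : ℝ => ‖u s.toNNReal - u t.toNNReal‖)
        (nhdsWithin t (Ici 0)) (nhds 0) := by
      have : Continuous fun s : ℝ => ‖u s.toNNReal - u t.toNNReal‖ := by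
        have := u.continuous
        have h' : Continuous Real.toNNReal := continuous_real_toNNReal
        fun_prop
      simpa using (this.tendsto t).mono_left nhdsWithin_le_nhds
    rw [hasDerivWithinAt_iff_isLittleO]
    have hbound : ∀ᶠ s in nhdsWithin t (Ici 0),
        |∫ x, (u s.toNNReal - u t.toNNReal : StateSpace) x * (φ (x + (t - s) * v) - φ x)| ≤
          (K * |v| * ‖k‖) * (‖u s.toNNReal - u t.toNNReal‖ * |s - t|) := by
      filter_upwards [hsmall] with s hs
      have := abs_integral_mul_le (u s.toNNReal - u t.toNNReal) k
        ((hm ((t - s) * v)).sub hm0) (c := K * |(t - s) * v|) ?_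
      · refine this.trans (le_of_eq ?_)
        rw [abs_mul, abs_sub_comm t s]; ring
      · filter_upwards [hk] with x hx
        rw [hx]
        by_cases hxS : x ∈ S
        · have := hK.dist_le_mul (x + (t - s) * v) x
          simpa [hxS, Real.dist_eq] using this
        · have hx1 : φ x = 0 := by
            by_contra h
            exact hxS (Metric.self_subset_cthickening _ (subset_tsupport φ h))
          have hx2 : φ (x + (t - s) * v) = 0 := by
            by_contra h
            refine hxS (Metric.mem_cthickening_of_dist_le x _ 1 _ (subset_tsupport φ h) ?_)
            simpa [Real.dist_eq, abs_mul] using hs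
          simp [hx1, hx2, hxS]
    have hO : (fun s : ℝ => ∫ x, (u s.toNNReal - u t.toNNReal : StateSpace) x *
        (φ (x + (t - s) * v) - φ x)) =O[nhdsWithin t (Ici 0)]
        fun s => ‖u s.toNNReal - u t.toNNReal‖ * |s - t| := by
      refine Asymptotics.IsBigO.of_bound (K * |v| * ‖k‖) ?_
      filter_upwards [hbound] with s hs
      simpa [abs_mul] using hs
    have ho : (fun s => ‖u s.toNNReal - u t.toNNReal‖ * |s - t|)
        =o[nhdsWithin t (Ici 0)] fun s => s - t := by
      have h1 := (Asymptotics.isLittleO_one_iff ℝ).2 hcont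
      have h2 : (fun s : ℝ => |s - t|) =O[nhdsWithin t (Ici 0)] fun s => s - t :=
        (Asymptotics.isBigO_refl _ _).norm_left
      simpa using h1.mul_isBigO h2
    simpa using hO.trans_isLittleO ho
  have h4 := (h1.add h2.hasDerivWithinAt).add h3
  have h5 := h4.sub_const (∫ x, (u t.toNNReal : ℝ → ℝ) x * φ x)
  refine (h5.congr_deriv (by ring)).congr_of_eventuallyEq
    (Filter.Eventually.of_forall fun s => ?_) ?_
  · simp only [Pi.add_apply]
    have i1 := integrable_mul_of_memLp (u s.toNNReal) hm0
    have i2 := integrable_mul_of_memLp (u t.toNNReal) (hm ((t - s) * v))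
    have i3 : Integrable fun x => (u s.toNNReal - u t.toNNReal : StateSpace) x *
        (φ (x + (t - s) * v) - φ x) :=
      integrable_mul_of_memLp _ ((hm ((t - s) * v)).sub hm0)
    have i4 := integrable_mul_of_memLp (u t.toNNReal) hm0
    rw [← integral_add' i1 i2, ← integral_add' (i1.add i2) i3,
      ← integral_sub' ((i1.add i2).add i3) i4]
    refine integral_congr_ae ?_
    filter_upwards [Lp.coeFn_sub (u s.toNNReal) (u t.toNNReal)] with x hx
    simp only [Pi.sub_apply, Pi.add_apply, hx]
    ring
  · simp

/-- Weak solutions are carried along the characteristics `x = x₀ + t v`. -/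
lemma eq_shiftState_of_weak_transport {v : ℝ} {u : C(ℝ≥0, StateSpace)}
    (hu : ∀ φ : ℝ → ℝ, ContDiff ℝ ∞ φ → HasCompactSupport φ → ∀ t : ℝ, 0 ≤ t →
      HasDerivWithinAt (fun s : ℝ => ∫ x, (u s.toNNReal : ℝ → ℝ) x * φ x)
        (v * ∫ x, (u t.toNNReal : ℝ → ℝ) x * deriv φ x) (Ici 0) t) (t : ℝ≥0) :
    u t = shiftState (t * v) (u 0) := by
  have hloc : ∀ f : StateSpace, LocallyIntegrable (f : ℝ → ℝ) volume := fun f =>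
    (Lp.memLp f).locallyIntegrable (by norm_num)
  refine Lp.ext (ae_eq_of_integral_contDiff_smul_eq (hloc _) (hloc _) fun φ hφ hc => ?_)
  simp only [smul_eq_mul]
  simp_rw [mul_comm (φ _)]
  rw [integral_shiftState_mul]
  -- The pairing with the test function transported backwards from time `t` is constant.
  set F : ℝ → ℝ := fun s => ∫ x, (u s.toNNReal : ℝ → ℝ) x * φ (x + (t - s) * v) with hF
  have hder : ∀ s : ℝ, 0 ≤ s → HasDerivWithinAt F 0 (Ici 0) s := fun s hs => by
    have := hasDerivWithinAt_pairing_zero hu (φ := fun x => φ (x + (t - s) * v))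
      (hφ.comp (contDiff_id.add contDiff_const)) (hasCompactSupport_comp_add hc _) hs
    convert this using 1
    ext r
    simp only [hF]
    congr 1 with x
    congr 2
    ring
  have hconst := constant_of_has_deriv_right_zero (f := F) (a := 0) (b := t)
    (fun s hs => ((hder s hs.1).continuousWithinAt).mono fun x hx => hx.1)
    (fun s hs => (hder s hs.1).mono (Ici_subset_Ici.2 hs.1)) t ⟨t.2, le_rfl⟩
  simpa [hF] using hconst

lemma weak_transport_shiftState (v : ℝ) (f : StateSpace) (φ : ℝ → ℝ) (hφ : ContDiff ℝ ∞ φ)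
    (hc : HasCompactSupport φ) (t : ℝ) (ht : 0 ≤ t) :
    HasDerivWithinAt (fun s : ℝ => ∫ x, shiftState (s.toNNReal * v) f x * φ x)
      (v * ∫ x, shiftState (t.toNNReal * v) f x * deriv φ x) (Ici 0) t := by
  simp_rw [integral_shiftState_mul, Real.coe_toNNReal t ht]
  have hin : HasDerivAt (fun s : ℝ => s * v) v t := by
    simpa using (hasDerivAt_id t).mul_const v
  have := HasDerivAt.scomp t (hasDerivAt_integral_mul_comp_add f hφ hc (t * v)) hin
  refine this.hasDerivWithinAt.congr (fun s hs => ?_) ?_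
  · simp [Real.coe_toNNReal s hs]
  · simp [Real.coe_toNNReal t ht]

/-! ### Polynomials times a Gaussian -/

lemma memLp_eval_mul_exp_neg_mul_sq {b : ℝ} (hb : 0 < b) (p : Polynomial ℝ) :
    MemLp (fun x => p.eval x * Real.exp (-(b * x ^ 2))) 2 volume := by
  have hint : ∀ q : Polynomial ℝ, Integrable fun x => q.eval x * Real.exp (-(2 * b * x ^ 2)) := by
    intro q
    simp_rw [Polynomial.eval_eq_sum_range, Finset.sum_mul]
    refine integrable_finsetSum _ fun j _ => ?_
    have := (integrable_rpow_mul_exp_neg_mul_sq (b := 2 * b) (by positivity)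
      (s := (j : ℝ)) (by have : (0 : ℝ) ≤ j := j.cast_nonneg; linarith)).const_mul (q.coeff j)
    refine this.congr (Filter.Eventually.of_forall fun x => ?_)
    simp only [Real.rpow_natCast]
    ring_nf
  rw [memLp_two_iff_integrable_sq (by fun_prop)]
  refine (hint (p ^ 2)).congr (Filter.Eventually.of_forall fun x => ?_)
  simp only [Polynomial.eval_pow, mul_pow, ← Real.exp_nat_mul]
  push_cast
  ring_nf

/-- The linear map sending a polynomial `p` to the state `p(x) exp(-b x²)`. -/
noncomputable def polynomialGaussian (b : ℝ) (hb : 0 < b) : Polynomial ℝ →ₗ[ℝ] StateSpace where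
  toFun p := (memLp_eval_mul_exp_neg_mul_sq hb p).toLp _
  map_add' p q := by
    rw [← MemLp.toLp_add]
    congr 1
    ext x
    simp [add_mul]
  map_smul' c p := by
    rw [RingHom.id_apply, ← MemLp.toLp_const_smul]
    congr 1
    ext x
    simp [mul_assoc]

lemma polynomialGaussian_ae (b : ℝ) (hb : 0 < b) (p : Polynomial ℝ) :
    (polynomialGaussian b hb p : ℝ → ℝ) =ᵐ[volume]
      fun x => p.eval x * Real.exp (-(b * x ^ 2)) :=
  MemLp.coeFn_toLp (memLp_eval_mul_exp_neg_mul_sq hb p)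

/-- The space of all `p(x) exp(-b x²)` with `deg p < N`. -/
noncomputable def polynomialGaussianSpace (b : ℝ) (hb : 0 < b) (N : ℕ) :
    Submodule ℝ StateSpace :=
  (Polynomial.degreeLT ℝ N).map (polynomialGaussian b hb)

lemma finite_polynomialGaussianSpace (b : ℝ) (hb : 0 < b) (N : ℕ) :
    FiniteDimensional ℝ (polynomialGaussianSpace b hb N) ∧
      Module.finrank ℝ (polynomialGaussianSpace b hb N) ≤ N := by
  have : FiniteDimensional ℝ (Polynomial.degreeLT ℝ N) :=
    (Polynomial.degreeLTEquiv ℝ N).symm.finiteDimensional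
  refine ⟨by unfold polynomialGaussianSpace; infer_instance, ?_⟩
  refine (Submodule.finrank_map_le _ _).trans ?_
  rw [(Polynomial.degreeLTEquiv ℝ N).finrank_eq]
  simp

/-! ### Exponential approximation of Gaussians -/

/-- The Taylor remainder of the exponential is geometrically small, at the price of a larger
exponent: each omitted term gains a factor `ρ⁻¹` against the same term of `exp (ρ |z|)`. -/
lemma abs_exp_sub_sum_le (z : ℝ) {ρ : ℝ} (hρ : 1 ≤ ρ) (K : ℕ) :
    |Real.exp z - ∑ k ∈ Finset.range K, z ^ k / k.factorial| ≤
      (ρ ^ K)⁻¹ * Real.exp (ρ * |z|) := by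
  have hz : HasSum (fun k : ℕ => z ^ k / k.factorial) (Real.exp z) := by
    simpa [Real.exp_eq_exp_ℝ] using NormedSpace.expSeries_div_hasSum_exp z
  have hy : HasSum (fun k : ℕ => (ρ * |z|) ^ k / k.factorial) (Real.exp (ρ * |z|)) := by
    simpa [Real.exp_eq_exp_ℝ] using NormedSpace.expSeries_div_hasSum_exp (ρ * |z|)
  have hρ0 : 0 < ρ := by linarith
  have h1 := (hasSum_nat_add_iff' K).2 hz
  have h2 := (hasSum_nat_add_iff' K).2 hy
  rw [← h1.tsum_eq, ← Real.norm_eq_abs]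
  have h3 := tsum_of_norm_bounded (f := fun k : ℕ => z ^ (k + K) / ((k + K).factorial : ℝ))
    (h2.mul_left (ρ ^ K)⁻¹) (fun k => ?_)
  · refine h3.trans ?_
    gcongr
    rw [sub_le_self_iff]
    positivity
  · rw [Real.norm_eq_abs, abs_div, abs_pow, Nat.abs_cast, mul_pow, pow_add ρ]
    have : (1 : ℝ) ≤ ρ ^ k := one_le_pow₀ hρ
    have e : (ρ ^ K)⁻¹ * (ρ ^ k * ρ ^ K * |z| ^ (k + K) / ((k + K).factorial : ℝ)) =
        ρ ^ k * (|z| ^ (k + K) / ((k + K).factorial : ℝ)) := by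
      field_simp
    rw [e]
    exact le_mul_of_one_le_left (by positivity) this

/-- Gaussians `A exp(-a x² + b x)` whose exponents `a` stay in `[α, a₀]` with `α > 0` are
exponentially well approximated by polynomials times the narrowest Gaussian `exp(-a₀ x²)`:
Taylor expansion of `exp((a₀ - a) x² + b x)` is dominated by `exp(-a₀ x²)` since
`a₀ - a ≤ a₀ - α < a₀`. -/
lemma exists_approx_gaussian {α a₀ : ℝ} (hα : 0 < α) (ha₀ : 0 < a₀) (A B : ℝ) :
    ∃ C ρ : ℝ, 0 < C ∧ 1 < ρ ∧ ∀ (K : ℕ) (f : StateSpace) (A' a b : ℝ), |A'| ≤ A → α ≤ a →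
      a ≤ a₀ → |b| ≤ B →
      (f : ℝ → ℝ) =ᵐ[volume] (fun x => A' * Real.exp (-(a * x ^ 2) + b * x)) →
      ∃ g ∈ polynomialGaussianSpace a₀ ha₀ (2 * K), ‖f - g‖ ≤ C * (ρ ^ K)⁻¹ := by
  -- any `ρ > 1` with `ρ (a₀ - α / 2) ≤ a₀ - α / 4` serves
  set ρ : ℝ := 1 + α / (4 * a₀) with hρdef
  have hρ : 1 < ρ := by
    rw [hρdef]
    linarith [show 0 < α / (4 * a₀) by positivity]
  have hα4 : 0 < α / 4 := by positivity
  set k : StateSpace := polynomialGaussian (α / 4) hα4 1 with hk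
  -- the constant that absorbs the linear term `B |x| ≤ (α / 2) x² + B² / (2 α)`
  set M : ℝ := Real.exp (ρ * (B ^ 2 / (2 * α))) with hM
  refine ⟨|A| * M * ‖k‖ + 1, ρ, by positivity, hρ, fun K f A' a b hA' hαa haa hb hf => ?_⟩
  set p : Polynomial ℝ := A' • ∑ j ∈ Finset.range K, ((j.factorial : ℝ)⁻¹) •
    (Polynomial.C (a₀ - a) * Polynomial.X ^ 2 + Polynomial.C b * Polynomial.X) ^ j with hp
  have hpmem : p ∈ Polynomial.degreeLT ℝ (2 * K) := by
    refine Submodule.smul_mem _ _ (Submodule.sum_mem _ fun j hj => Submodule.smul_mem _ _ ?_)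
    rw [Polynomial.mem_degreeLT]
    have hj' : j < K := Finset.mem_range.1 hj
    have h2 : (Polynomial.C (a₀ - a) * Polynomial.X ^ 2 +
        Polynomial.C b * Polynomial.X).natDegree ≤ 2 := by compute_degree
    refine (Polynomial.degree_le_natDegree).trans_lt ?_
    have := Polynomial.natDegree_pow_le_of_le j h2
    exact_mod_cast this.trans_lt (by omega)
  refine ⟨polynomialGaussian a₀ ha₀ p, Submodule.mem_map_of_mem hpmem, ?_⟩
  have hmain : ‖f - polynomialGaussian a₀ ha₀ p‖ ≤ (|A| * M * (ρ ^ K)⁻¹) * ‖k‖ := by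
    refine Lp.norm_le_mul_norm_of_ae_le_mul ?_
    filter_upwards [hf, polynomialGaussian_ae a₀ ha₀ p, Lp.coeFn_sub f (polynomialGaussian a₀ ha₀ p),
      polynomialGaussian_ae (α / 4) hα4 1] with x h1 h2 h3 h4
    rw [h3, Pi.sub_apply, h1, h2, hk, h4, Real.norm_eq_abs, Real.norm_eq_abs]
    set z : ℝ := (a₀ - a) * x ^ 2 + b * x with hz
    have hpe : p.eval x = A' * ∑ j ∈ Finset.range K, z ^ j / j.factorial := by
      simp only [hp, Polynomial.eval_smul, Polynomial.eval_finsetSum, Polynomial.eval_pow,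
        Polynomial.eval_add, Polynomial.eval_mul, Polynomial.eval_C, Polynomial.eval_X,
        smul_eq_mul, hz]
      congr 1
      refine Finset.sum_congr rfl fun j _ => ?_
      rw [div_eq_inv_mul]
    have hsplit : A' * Real.exp (-(a * x ^ 2) + b * x) - p.eval x * Real.exp (-(a₀ * x ^ 2)) =
        A' * ((Real.exp z - ∑ j ∈ Finset.range K, z ^ j / j.factorial) *
          Real.exp (-(a₀ * x ^ 2))) := by
      have : Real.exp (-(a * x ^ 2) + b * x) = Real.exp z * Real.exp (-(a₀ * x ^ 2)) := by
        rw [← Real.exp_add, hz]; ring_nf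
      rw [this, hpe]; ring
    have hzle : |z| ≤ (a₀ - α / 2) * x ^ 2 + B ^ 2 / (2 * α) := by
      have hbx : |b * x| ≤ α / 2 * x ^ 2 + B ^ 2 / (2 * α) := by
        have h5 : |b * x| ≤ B * |x| := by rw [abs_mul]; gcongr
        have h6 : α / 2 * x ^ 2 + B ^ 2 / (2 * α) - B * |x| = (α * |x| - B) ^ 2 / (2 * α) := by
          rw [← sq_abs x]; field_simp; ring
        have h7 : 0 ≤ (α * |x| - B) ^ 2 / (2 * α) := by positivity
        linarith
      have hsq : |(a₀ - a) * x ^ 2| ≤ (a₀ - α) * x ^ 2 := by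
        rw [abs_mul, abs_of_nonneg (sub_nonneg.2 haa), abs_of_nonneg (sq_nonneg x)]
        gcongr
      calc |z| ≤ _ := abs_add_le _ _
        _ ≤ _ := add_le_add hsq hbx
        _ = _ := by ring
    have hexp : ρ * |z| + -(a₀ * x ^ 2) ≤ ρ * (B ^ 2 / (2 * α)) + -(α / 4 * x ^ 2) := by
      have h8 : ρ * |z| ≤ ρ * ((a₀ - α / 2) * x ^ 2 + B ^ 2 / (2 * α)) := by gcongr
      have h9 : ρ * (a₀ - α / 2) ≤ a₀ - α / 4 := by
        have : ρ * (a₀ - α / 2) = a₀ - α / 4 - α ^ 2 / (8 * a₀) := by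
          rw [hρdef]; field_simp; ring
        have h10 : 0 ≤ α ^ 2 / (8 * a₀) := by positivity
        linarith
      have h11 := mul_le_mul_of_nonneg_right h9 (sq_nonneg x)
      nlinarith
    rw [hsplit, abs_mul, abs_mul, Real.abs_exp, abs_mul, Real.abs_exp, Polynomial.eval_one, abs_one,
      one_mul]
    calc |A'| * (|Real.exp z - ∑ j ∈ Finset.range K, z ^ j / j.factorial| *
          Real.exp (-(a₀ * x ^ 2)))
        ≤ |A| * (((ρ ^ K)⁻¹ * Real.exp (ρ * |z|)) * Real.exp (-(a₀ * x ^ 2))) := by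
          have := hA'.trans (le_abs_self A)
          have := abs_exp_sub_sum_le z hρ.le K
          gcongr ?_ * (?_ * _)
      _ = |A| * (ρ ^ K)⁻¹ * Real.exp (ρ * |z| + -(a₀ * x ^ 2)) := by rw [Real.exp_add]; ring
      _ ≤ |A| * (ρ ^ K)⁻¹ * Real.exp (ρ * (B ^ 2 / (2 * α)) + -(α / 4 * x ^ 2)) := by gcongr
      _ = |A| * M * (ρ ^ K)⁻¹ * Real.exp (-(α / 4 * x ^ 2)) := by rw [Real.exp_add, hM]; ring
  refine hmain.trans ?_
  have : 0 ≤ (ρ ^ K)⁻¹ := by positivity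
  nlinarith

/-! ### Translates escape every finite-dimensional subspace -/

lemma exists_norm_sub_le_and_eq_zero_of_lt_abs (f : StateSpace) {ε : ℝ} (hε : 0 < ε) :
    ∃ g : StateSpace, ‖f - g‖ ≤ ε ∧ ∃ R : ℝ, ∀ᵐ x : ℝ, R < |x| → g x = 0 := by
  obtain ⟨φ, hc, hφ, -, hm⟩ := (Lp.memLp f).exists_hasCompactSupport_eLpNorm_sub_le
    (by norm_num) (ENNReal.ofReal_pos.2 hε).ne'
  refine ⟨hm.toLp φ, ?_, ?_⟩
  · have e : f - hm.toLp φ = ((Lp.memLp f).sub hm).toLp _ := by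
      rw [MemLp.toLp_sub (Lp.memLp f) hm, Lp.toLp_coeFn]
    rw [e, Lp.norm_toLp]
    exact ENNReal.toReal_le_of_le_ofReal hε.le hφ
  · obtain ⟨R, hR⟩ := hc.isCompact.isBounded.subset_closedBall 0
    refine ⟨R, ?_⟩
    filter_upwards [hm.coeFn_toLp] with x hx hxR
    rw [hx]
    by_contra h
    have := hR (subset_tsupport φ h)
    rw [mem_closedBall_zero_iff, Real.norm_eq_abs] at this
    linarith

lemma shiftState_sub (a : ℝ) (f g : StateSpace) :
    shiftState a (f - g) = shiftState a f - shiftState a g :=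
  DomAddAct.vadd_Lp_sub _ _ _

/-- The translates of a state tend weakly to zero: up to a small error both functions have bounded
support, and then the supports are eventually disjoint. -/
lemma tendsto_inner_shiftState (f y : StateSpace) :
    Filter.Tendsto (fun a => inner ℝ y (shiftState a f)) (Filter.comap (fun a => |a|) Filter.atTop)
      (nhds 0) := by
  rw [Metric.tendsto_nhds]
  intro ε hε
  obtain ⟨g, hg, R, hR⟩ := exists_norm_sub_le_and_eq_zero_of_lt_abs f
    (ε := ε / (3 * (‖y‖ + 1))) (by positivity)
  obtain ⟨h, hh, R', hR'⟩ := exists_norm_sub_le_and_eq_zero_of_lt_abs y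
    (ε := ε / (3 * (‖g‖ + 1))) (by positivity)
  have hev : ∀ᶠ a in Filter.comap (fun a : ℝ => |a|) Filter.atTop, R + R' < |a| :=
    Filter.Eventually.comap (Filter.eventually_gt_atTop _) _
  filter_upwards [hev] with a ha
  have h0 : inner ℝ h (shiftState a g) = 0 := by
    rw [L2.inner_def]
    refine integral_eq_zero_of_ae ?_
    have hRa : ∀ᵐ x : ℝ, R < |x - a| → g (x - a) = 0 :=
      (measurePreserving_sub_right volume a).quasiMeasurePreserving.ae hR
    filter_upwards [shiftState_ae a g, hRa, hR'] with x h1 h2 h3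
    by_cases hx : R' < |x|
    · simp [h3 hx]
    · have h4 : R < |x - a| := by
        have := abs_sub_abs_le_abs_sub a x
        rw [abs_sub_comm a x] at this
        linarith [not_lt.1 hx]
      simp [h1, h2 h4]
  have hdec : inner ℝ y (shiftState a f) =
      inner ℝ y (shiftState a (f - g)) + inner ℝ (y - h) (shiftState a g) := by
    rw [shiftState_sub, inner_sub_right, inner_sub_left, h0]; ring
  have b1 : |inner ℝ y (shiftState a (f - g))| ≤ ε / 3 := by
    refine (abs_real_inner_le_norm _ _).trans ?_
    rw [norm_shiftState]
    calc ‖y‖ * ‖f - g‖ ≤ (‖y‖ + 1) * (ε / (3 * (‖y‖ + 1))) := by gcongr; linarith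
      _ = ε / 3 := by field_simp
  have b2 : |inner ℝ (y - h) (shiftState a g)| ≤ ε / 3 := by
    refine (abs_real_inner_le_norm _ _).trans ?_
    rw [norm_shiftState]
    calc ‖y - h‖ * ‖g‖ ≤ (ε / (3 * (‖g‖ + 1))) * (‖g‖ + 1) := by gcongr; linarith
      _ = ε / 3 := by field_simp
  rw [Real.dist_eq, sub_zero, hdec]
  have := abs_add_le (inner ℝ y (shiftState a (f - g))) (inner ℝ (y - h) (shiftState a g))
  linarith

lemma tendsto_starProjection_shiftState (f : StateSpace) (Y : Submodule ℝ StateSpace)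
    [FiniteDimensional ℝ Y] :
    Filter.Tendsto (fun a => Y.starProjection (shiftState a f))
      (Filter.comap (fun a => |a|) Filter.atTop) (nhds 0) := by
  have b := stdOrthonormalBasis ℝ Y
  have e : ∀ a, Y.starProjection (shiftState a f) =
      ∑ i, inner ℝ (b i : StateSpace) (shiftState a f) • (b i : StateSpace) := fun a => by
    rw [Submodule.starProjection_apply, b.orthogonalProjectionOnto_apply_eq_sum]
    simp
  simp_rw [e]
  have : (0 : StateSpace) = ∑ i, (0 : ℝ) • (b i : StateSpace) := by simp
  rw [this]
  exact tendsto_finsetSum _ fun i _ => (tendsto_inner_shiftState f (b i)).smul_const _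

lemma norm_sub_starProjection_le_infEDist {V : Type*} [NormedAddCommGroup V]
    [InnerProductSpace ℝ V] (Y : Submodule ℝ V) [Y.HasOrthogonalProjection] (w : V) :
    ENNReal.ofReal (‖w‖ - ‖Y.starProjection w‖) ≤ Metric.infEDist w (Y : Set V) := by
  rw [Metric.le_infEDist]
  intro y hy
  rw [edist_dist, dist_eq_norm]
  refine ENNReal.ofReal_le_ofReal ?_
  have h1 : ‖w - Y.starProjection w‖ ≤ ‖w - y‖ := by
    rw [Submodule.starProjection_minimal]
    exact ciInf_le ⟨0, by rintro _ ⟨x, rfl⟩; exact norm_nonneg _⟩ (⟨y, hy⟩ : Y)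
  have h2 := norm_sub_norm_le w (Y.starProjection w)
  linarith

/-! ### The Gaussian transport problem -/

lemma travellingGaussian_eq (θ : ℝ × ℝ) (t : ℝ) :
    travellingGaussian θ t = fun x => initialGaussian θ (x - t * θ.2) := rfl

lemma travellingGaussian_eq_exp (θ : ℝ × ℝ) (hθ : θ.1 ≠ 0) (t x : ℝ) :
    travellingGaussian θ t x =
      (1 / (Real.sqrt (2 * Real.pi) * θ.1) *
        Real.exp (-((t * θ.2) ^ 2 / (2 * θ.1 ^ 2)))) *
      Real.exp (-(1 / (2 * θ.1 ^ 2) * x ^ 2) + t * θ.2 / θ.1 ^ 2 * x) := by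
  rw [travellingGaussian, mul_assoc, ← Real.exp_add]
  congr 2
  field_simp
  ring

/-- The initial Gaussian as a state. -/
noncomputable def gaussianState (θ : ℝ × ℝ) (hθ : θ.1 ≠ 0) : StateSpace :=
  (1 / (Real.sqrt (2 * Real.pi) * θ.1)) • polynomialGaussian (1 / (2 * θ.1 ^ 2)) (by positivity) 1

lemma gaussianState_ae (θ : ℝ × ℝ) (hθ : θ.1 ≠ 0) :
    (gaussianState θ hθ : ℝ → ℝ) =ᵐ[volume] initialGaussian θ := by
  filter_upwards [Lp.coeFn_smul (1 / (Real.sqrt (2 * Real.pi) * θ.1))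
    (polynomialGaussian (1 / (2 * θ.1 ^ 2)) (by positivity) 1),
    polynomialGaussian_ae (1 / (2 * θ.1 ^ 2)) (by positivity) 1] with x h1 h2
  rw [gaussianState, h1, Pi.smul_apply, h2, initialGaussian, Polynomial.eval_one, one_mul,
    smul_eq_mul]
  congr 3
  field_simp

lemma gaussianState_ne_zero (θ : ℝ × ℝ) (hθ : θ.1 ≠ 0) : gaussianState θ hθ ≠ 0 := by
  intro h
  have h1 := gaussianState_ae θ hθ
  rw [h] at h1
  have h2 : ∀ᵐ _ : ℝ, False := by
    filter_upwards [h1, Lp.coeFn_zero ℝ 2 (volume : Measure ℝ)] with x hx hx'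
    rw [hx', Pi.zero_apply, initialGaussian] at hx
    have : 1 / (Real.sqrt (2 * Real.pi) * θ.1) * Real.exp (-(x ^ 2 / (2 * θ.1 ^ 2))) ≠ 0 := by
      positivity
    exact this hx.symm
  exact NeZero.ne (volume : Measure ℝ) (by simpa using h2)

lemma isTransportSolution_iff (θ : ℝ × ℝ) (hθ : θ.1 ≠ 0) (u : C(ℝ≥0, StateSpace)) :
    IsTransportSolution θ u ↔ ∀ t : ℝ≥0, u t = shiftState (t * θ.2) (gaussianState θ hθ) := by
  constructor
  · intro h t
    have h0 : u 0 = gaussianState θ hθ := Lp.ext (h.initial.trans (gaussianState_ae θ hθ).symm)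
    rw [← h0]
    exact eq_shiftState_of_weak_transport h.equation t
  · intro h
    refine ⟨?_, fun φ hφ hc t ht => ?_⟩
    · rw [h 0]
      simpa [shiftState_zero] using gaussianState_ae θ hθ
    · simp_rw [h]
      exact weak_transport_shiftState θ.2 _ φ hφ hc t ht

/-- The trajectory of the Gaussian moving with speed `θ₂`. -/
noncomputable def gaussianTrajectory (θ : ℝ × ℝ) (hθ : θ.1 ≠ 0) : C(ℝ≥0, StateSpace) where
  toFun t := shiftState (t * θ.2) (gaussianState θ hθ)
  continuous_toFun := (continuous_shiftState _).comp (by fun_prop)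

lemma isTransportSolution_gaussianTrajectory (θ : ℝ × ℝ) (hθ : θ.1 ≠ 0) :
    IsTransportSolution θ (gaussianTrajectory θ hθ) :=
  (isTransportSolution_iff θ hθ _).2 fun _ => rfl

lemma IsTransportSolution.ae_eq_travellingGaussian {θ : ℝ × ℝ} (hθ : θ.1 ≠ 0)
    {u : C(ℝ≥0, StateSpace)} (hu : IsTransportSolution θ u) (t : ℝ≥0) :
    (u t : ℝ → ℝ) =ᵐ[volume] travellingGaussian θ t := by
  rw [(isTransportSolution_iff θ hθ u).1 hu t, travellingGaussian_eq]
  exact (shiftState_ae _ _).trans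
    ((measurePreserving_sub_right volume (t * θ.2)).quasiMeasurePreserving.ae_eq_comp
      (gaussianState_ae θ hθ))

/-- On a compact parameter set the coefficients of the Gaussians at time `t` are bounded, and the
exponents are bounded away from zero. -/
lemma exists_coefficient_bounds {Θ : Set (ℝ × ℝ)} (hΘ : IsCompact Θ)
    (hwidth : ∀ θ ∈ Θ, θ.1 ≠ 0) (t : ℝ) :
    ∃ α a₀ A B : ℝ, 0 < α ∧ α ≤ a₀ ∧ ∀ θ ∈ Θ,
      |1 / (Real.sqrt (2 * Real.pi) * θ.1) *
        Real.exp (-((t * θ.2) ^ 2 / (2 * θ.1 ^ 2)))| ≤ A ∧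
      α ≤ 1 / (2 * θ.1 ^ 2) ∧ 1 / (2 * θ.1 ^ 2) ≤ a₀ ∧ |t * θ.2 / θ.1 ^ 2| ≤ B := by
  have hpi : Real.sqrt (2 * Real.pi) ≠ 0 := by positivity
  obtain ⟨A, hA⟩ := hΘ.exists_bound_of_continuousOn (f := fun θ : ℝ × ℝ =>
    1 / (Real.sqrt (2 * Real.pi) * θ.1) * Real.exp (-((t * θ.2) ^ 2 / (2 * θ.1 ^ 2))))
    (by
      have h1 : ∀ θ ∈ Θ, Real.sqrt (2 * Real.pi) * θ.1 ≠ 0 := fun θ h => mul_ne_zero hpi (hwidth θ h)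
      have h2 : ∀ θ ∈ Θ, 2 * θ.1 ^ 2 ≠ 0 := fun θ h => by have := hwidth θ h; positivity
      fun_prop (disch := assumption))
  obtain ⟨B, hB⟩ := hΘ.exists_bound_of_continuousOn (f := fun θ : ℝ × ℝ => t * θ.2 / θ.1 ^ 2)
    (by
      have h2 : ∀ θ ∈ Θ, θ.1 ^ 2 ≠ 0 := fun θ h => by have := hwidth θ h; positivity
      fun_prop (disch := assumption))
  obtain ⟨D, hD⟩ := hΘ.exists_bound_of_continuousOn (f := fun θ : ℝ × ℝ => 1 / (2 * θ.1 ^ 2))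
    (by
      have h2 : ∀ θ ∈ Θ, 2 * θ.1 ^ 2 ≠ 0 := fun θ h => by have := hwidth θ h; positivity
      fun_prop (disch := assumption))
  obtain ⟨E, hE⟩ := hΘ.exists_bound_of_continuousOn (f := fun θ : ℝ × ℝ => 2 * θ.1 ^ 2)
    (by fun_prop)
  have hE1 : (0 : ℝ) < |E| + 1 := by positivity
  refine ⟨1 / (|E| + 1), max D (1 / (|E| + 1)), A, B, by positivity, le_max_right _ _,
    fun θ h => ⟨hA θ h, ?_, ?_, hB θ h⟩⟩
  · have := hwidth θ h
    refine one_div_le_one_div_of_le (by positivity) ?_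
    linarith [le_abs_self (2 * θ.1 ^ 2), hE θ h, le_abs_self E, Real.norm_eq_abs (2 * θ.1 ^ 2)]
  · exact (le_abs_self _).trans ((hD θ h).trans (le_max_left _ _))

/-! ### The widths of the trajectory set -/

/-- A geometric bound in half the dimension is exponential decay in the dimension. -/
lemma inv_pow_half_le {ρ : ℝ} (hρ : 1 < ρ) (n : ℕ) :
    (ρ ^ (n / 2))⁻¹ ≤ ρ * Real.exp (-(Real.log ρ / 2 * n)) := by
  have h0 : 0 < ρ := by linarith
  have hlog := Real.log_pos hρ
  have e1 : (ρ ^ (n / 2))⁻¹ = Real.exp (-(Real.log ρ * (n / 2 : ℕ))) := by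
    rw [Real.exp_neg, mul_comm, Real.exp_nat_mul, Real.exp_log h0]
  have e2 : ρ * Real.exp (-(Real.log ρ / 2 * n)) =
      Real.exp (Real.log ρ + -(Real.log ρ / 2 * n)) := by
    rw [Real.exp_add, Real.exp_log h0]
  rw [e1, e2, Real.exp_le_exp]
  have : (n : ℝ) ≤ 2 * (n / 2 : ℕ) + 2 := by exact_mod_cast (by omega : n ≤ 2 * (n / 2) + 2)
  nlinarith

lemma kolmogorovWidth_timeSlice_le {Θ : Set (ℝ × ℝ)} (hΘ : IsCompact Θ)
    (hwidth : ∀ θ ∈ Θ, θ.1 ≠ 0) (t : ℝ≥0) :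
    ∃ C : ℝ, 0 < C ∧ ∃ c : ℝ, 0 < c ∧ ∀ n : ℕ,
      kolmogorovWidth n (timeSlice (transportTrajectories Θ) t) ≤
        ENNReal.ofReal (C * Real.exp (-(c * n))) := by
  obtain ⟨α, a₀, A, B, hα, hle, hbd⟩ := exists_coefficient_bounds hΘ hwidth t
  obtain ⟨C, ρ, hC, hρ, happ⟩ := exists_approx_gaussian hα (hα.trans_le hle) A B
  refine ⟨C * ρ, by positivity, Real.log ρ / 2, half_pos (Real.log_pos hρ), fun n => ?_⟩
  have hY := finite_polynomialGaussianSpace a₀ (hα.trans_le hle) (2 * (n / 2))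
  refine (iInf₂_le _ ⟨hY.1, hY.2.trans (by omega)⟩).trans ?_
  refine iSup₂_le ?_
  rintro _ ⟨u, ⟨θ, hθ, hu⟩, rfl⟩
  obtain ⟨h1, h2, h3, h4⟩ := hbd θ hθ
  obtain ⟨g, hg, hfg⟩ := happ (n / 2) (u t) _ _ _ h1 h2 h3 h4
    ((hu.ae_eq_travellingGaussian (hwidth θ hθ) t).trans
      (Filter.Eventually.of_forall fun x => travellingGaussian_eq_exp θ (hwidth θ hθ) t x))
  refine (Metric.infEDist_le_edist_of_mem hg).trans ?_
  rw [edist_dist, dist_eq_norm]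
  refine ENNReal.ofReal_le_ofReal (hfg.trans ?_)
  rw [mul_assoc]
  gcongr
  exact inv_pow_half_le hρ n

lemma trajectoryWidth_transportTrajectories_le {Θ : Set (ℝ × ℝ)} (hΘ : IsCompact Θ)
    (hwidth : ∀ θ ∈ Θ, θ.1 ≠ 0) :
    ∃ C : ℝ, 0 < C ∧ ∀ n : ℕ,
      trajectoryWidth n (transportTrajectories Θ) ≤ ENNReal.ofReal C := by
  obtain ⟨α, a₀, A, B, hα, hle, hbd⟩ := exists_coefficient_bounds hΘ hwidth 0
  obtain ⟨C, ρ, hC, hρ, happ⟩ := exists_approx_gaussian hα (hα.trans_le hle) A B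
  refine ⟨C, hC, fun n => ?_⟩
  -- Translations preserve the norm, so the zero subspace already gives a bound.
  refine (iInf₂_le (⊥ : Submodule ℝ StateSpace) ⟨inferInstance, by simp⟩).trans ?_
  refine iSup₂_le ?_
  rintro u ⟨θ, hθ, hu⟩
  refine iSup_le fun t => ?_
  obtain ⟨h1, h2, h3, h4⟩ := hbd θ hθ
  have h0 := hu.ae_eq_travellingGaussian (hwidth θ hθ) 0
  rw [NNReal.coe_zero] at h0
  -- With no Taylor terms the approximation lemma bounds the norm itself, uniformly in `θ`.
  obtain ⟨g, hg, hfg⟩ := happ 0 (u 0) _ _ _ h1 h2 h3 h4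
    (h0.trans (Filter.Eventually.of_forall fun x =>
      travellingGaussian_eq_exp θ (hwidth θ hθ) 0 x))
  have hg0 : g = 0 := by
    have hY := finite_polynomialGaussianSpace a₀ (hα.trans_le hle) (2 * 0)
    have := hY.1
    have hbot := Submodule.finrank_eq_zero.1 (Nat.le_zero.1 hY.2)
    rwa [hbot, Submodule.mem_bot] at hg
  refine (Metric.infEDist_le_edist_of_mem (y := 0) (by simp)).trans ?_
  rw [edist_dist, dist_eq_norm, sub_zero]
  refine ENNReal.ofReal_le_ofReal ?_
  have hnorm : ‖u t‖ = ‖u 0‖ := by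
    simp_rw [(isTransportSolution_iff θ (hwidth θ hθ) u).1 hu, norm_shiftState]
  rw [hnorm]
  simpa [hg0] using hfg

lemma le_trajectoryWidth_transportTrajectories {Θ : Set (ℝ × ℝ)} {θ : ℝ × ℝ} (hθΘ : θ ∈ Θ)
    (hθ : θ.1 ≠ 0) (hv : θ.2 ≠ 0) (n : ℕ) :
    ENNReal.ofReal ‖gaussianState θ hθ‖ ≤ trajectoryWidth n (transportTrajectories Θ) := by
  refine le_iInf₂ fun Y hY => ?_
  have := hY.1
  set f := gaussianState θ hθ
  have hescape : Filter.Tendsto (fun t : ℝ≥0 => (t : ℝ) * θ.2) Filter.atTop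
      (Filter.comap (fun a => |a|) Filter.atTop) := by
    rw [Filter.tendsto_comap_iff]
    have : Filter.Tendsto (fun t : ℝ≥0 => (t : ℝ) * |θ.2|) Filter.atTop Filter.atTop :=
      (NNReal.tendsto_coe_atTop.2 Filter.tendsto_id).atTop_mul_const (abs_pos.2 hv)
    refine this.congr fun t => ?_
    simp [abs_mul]
  have hlim : Filter.Tendsto (fun t : ℝ≥0 => ENNReal.ofReal
      (‖f‖ - ‖Y.starProjection (shiftState (t * θ.2) f)‖)) Filter.atTop
      (nhds (ENNReal.ofReal ‖f‖)) := by
    refine ENNReal.tendsto_ofReal ?_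
    simpa using ((tendsto_starProjection_shiftState f Y).comp hescape).norm.const_sub ‖f‖
  refine le_of_tendsto' hlim fun t => ?_
  have h1 := norm_sub_starProjection_le_infEDist Y (shiftState (t * θ.2) f)
  rw [norm_shiftState] at h1
  refine h1.trans ?_
  refine le_iSup₂_of_le (gaussianTrajectory θ hθ)
    ⟨θ, hθΘ, isTransportSolution_gaussianTrajectory θ hθ⟩ ?_
  exact le_iSup (fun t : ℝ≥0 => Metric.infEDist (gaussianTrajectory θ hθ t) (Y : Set StateSpace)) t

theorem mainTheorem5 (Θ : Set (ℝ × ℝ)) (hΘ : IsCompact Θ) (hwidth : ∀ θ ∈ Θ, θ.1 ≠ 0) :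
    -- well-posedness, and the explicit form of the solution
    (∀ θ ∈ Θ, (∃! u : C(ℝ≥0, StateSpace), IsTransportSolution θ u) ∧
      ∀ u : C(ℝ≥0, StateSpace), IsTransportSolution θ u →
        ∀ t : ℝ≥0, (u t : ℝ → ℝ) =ᵐ[volume] travellingGaussian θ t) ∧
    -- exponential decay of the widths of every time slice
    (∀ t : ℝ≥0, ∃ C : ℝ, 0 < C ∧ ∃ c : ℝ, 0 < c ∧ ∀ n : ℕ,
      kolmogorovWidth n (timeSlice (transportTrajectories Θ) t) ≤
        ENNReal.ofReal (C * Real.exp (-(c * n)))) ∧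
    -- the widths of the full trajectory set are bounded
    (∃ C : ℝ, 0 < C ∧ ∀ n : ℕ,
      trajectoryWidth n (transportTrajectories Θ) ≤ ENNReal.ofReal C) ∧
    -- and they do not decay, as soon as one of the Gaussians moves
    ((∃ θ ∈ Θ, θ.2 ≠ 0) → ∃ c : ℝ, 0 < c ∧ ∀ n : ℕ,
      ENNReal.ofReal c ≤ trajectoryWidth n (transportTrajectories Θ)) := by
  refine ⟨fun θ hθ => ⟨?_, fun u hu t => hu.ae_eq_travellingGaussian (hwidth θ hθ) t⟩,
    kolmogorovWidth_timeSlice_le hΘ hwidth, trajectoryWidth_transportTrajectories_le hΘ hwidth, ?_⟩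
  · refine ⟨gaussianTrajectory θ (hwidth θ hθ),
      isTransportSolution_gaussianTrajectory θ (hwidth θ hθ), fun u hu => ?_⟩
    ext1 t
    exact (isTransportSolution_iff θ (hwidth θ hθ) u).1 hu t
  · rintro ⟨θ, hθ, hv⟩
    exact ⟨‖gaussianState θ (hwidth θ hθ)‖, norm_pos_iff.2 (gaussianState_ne_zero θ _),
      le_trajectoryWidth_transportTrajectories hθ (hwidth θ hθ) hv⟩
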